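/- Let $N,d\in\mathbb N$ and let $a_{jk}:[0,+\infty)\to\mathbb R$, $j,k=1,\dots,N$, be Lebesgue measurable functions that are (essentially) bounded and satisfy $a_{jk}(t)\ge 0$ for a.e. $t$. For $T,\mu>0$ and $t\ge 0$ let $G_{T,\mu}(t)$ be the directed graph with nodes $1,\dots,N$ which has an arrow $j\to k$ if and only if $$\int_t^{t+T}a_{jk}(\tau)\,d\tau\ge\mu$$ (arrows $j\to j$, given by $a_{jj}$, are allowed). A node $\ell$ of a directed graph is globally reachable if from every node there is a directed path (possibly of length $0$) to $\ell$. Assume that at least one of the following conditions holds: - (Moreau) there exist $T,\mu>0$ such that the time-independent graph, whose arrows are those $j\to k$ that belong to $G_{T,\mu}(t)$ for all $t\ge0$, has a globally reachable node; - (Integral Scrambling Coefficient, ISC) there exist $T,\mu>0$ such that for all $i\ne j$ and all $t\ge 0$ there exists an index $k=k_{ij}(t)$ such that both arrows $i\to k$ and $j\to k$ belong to $G_{T,\mu}(t)$; - (Persistent Excitation, PE) there exist $T,\mu>0$ such that for all $j\ne k$ and all $t\ge0$ the arrow $j\to k$ belongs to $G_{T,\mu}(t)$. Then every trajectory of $$\dot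 x_j=\sum_{k=1}^N a_{jk}(t)\,(x_k-x_j),\qquad x_j(t)\in\mathbb R^d,\quad j=1,\dots,N,$$ converges to consensus. That is, if $x_1,\dots,x_N:[0,+\infty)\to\mathbb R^d$ are absolutely continuous on compact intervals and satisfy the system for almost every $t\geq 0$, then there exists $x^*\in\mathbb R^d$ such that $\lim_{t\to+\infty}x_j(t)=x^*$ for all $j=1,\dots,N$. -/

import Mathlib

open MeasureTheory Filter Topology

/-- The restriction of Lebesgue measure to the half-line `[0, ∞)` of times. -/
noncomputable def timeMeasure : Measure ℝ := volume.restrict (Set.Ici 0)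

/-- Bounded nonnegative (Lebesgue measurable) connection functions `a j k` on `[0, ∞)`. Values at
negative times play no role, and null sets of times are ignored, as in the dynamics. -/
structure IsBoundedSignal {N : ℕ} (a : Fin N → Fin N → ℝ → ℝ) : Prop where
  measurable : ∀ j k, AEMeasurable (a j k) timeMeasure
  nonneg : ∀ j k, ∀ᵐ t ∂timeMeasure, 0 ≤ a j k t
  bounded : ∃ M : ℝ, ∀ j k, ∀ᵐ t ∂timeMeasure, a j k t ≤ M

/-- A Carathéodory solution on `[0, ∞)` of `ẋ_j = ∑ k, a_{jk}(t) (x_k - x_j)`: every `x j` is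
absolutely continuous on each compact interval `[0, S]`, and the equation holds at almost
every time. -/
structure IsTrajectory {N d : ℕ} (a : Fin N → Fin N → ℝ → ℝ)
    (x : Fin N → ℝ → EuclideanSpace ℝ (Fin d)) : Prop where
  absolutelyContinuous : ∀ j, ∀ S : ℝ, 0 ≤ S → AbsolutelyContinuousOnInterval (x j) 0 S
  hasDerivAt : ∀ j, ∀ᵐ t ∂timeMeasure,
    HasDerivAt (x j) (∑ k, a j k t • (x k t - x j t)) t

/-- All agents converge, as `t → ∞`, to one common point. -/
def ConvergesToConsensus {N d : ℕ} (x : Fin N → ℝ → EuclideanSpace ℝ (Fin d)) : Prop :=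
  ∃ p : EuclideanSpace ℝ (Fin d), ∀ j, Tendsto (x j) atTop (𝓝 p)

/-- A directed graph has a node which can be reached from every node along a directed path. -/
def HasGloballyReachableNode {V : Type*} (G : Digraph V) : Prop :=
  ∃ l, ∀ i, Relation.ReflTransGen G.Adj i l

/-- The graph `G(t)`: an arrow from `j` to `k` when `∫_t^{t+T} a_{jk} ≥ μ`. -/
def windowGraph {N : ℕ} (a : Fin N → Fin N → ℝ → ℝ) (T μ t : ℝ) : Digraph (Fin N) where
  Adj j k := μ ≤ ∫ s in t..(t + T), a j k s

/-- The time-independent graph with an arrow from `j` to `k` when the arrow is in `G(t)` for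
all `t ≥ 0`. -/
def persistentGraph {N : ℕ} (a : Fin N → Fin N → ℝ → ℝ) (T μ : ℝ) : Digraph (Fin N) where
  Adj j k := ∀ t : ℝ, 0 ≤ t → (windowGraph a T μ t).Adj j k

/-- Moreau condition. -/
def MoreauCondition {N : ℕ} (a : Fin N → Fin N → ℝ → ℝ) : Prop :=
  ∃ T μ : ℝ, 0 < T ∧ 0 < μ ∧ HasGloballyReachableNode (persistentGraph a T μ)

/-- Integral Scrambling Coefficient condition. The node `k` may depend on `i`, `j` and `t`. -/
def IntegralScramblingCondition {N : ℕ} (a : Fin N → Fin N → ℝ → ℝ) : Prop :=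
  ∃ T μ : ℝ, 0 < T ∧ 0 < μ ∧ ∀ i j : Fin N, i ≠ j → ∀ t : ℝ, 0 ≤ t →
    ∃ k, (windowGraph a T μ t).Adj i k ∧ (windowGraph a T μ t).Adj j k

/-- Persistent Excitation condition. -/
def PersistentExcitation {N : ℕ} (a : Fin N → Fin N → ℝ → ℝ) : Prop :=
  ∃ T μ : ℝ, 0 < T ∧ 0 < μ ∧ ∀ j k : Fin N, j ≠ k → ∀ t : ℝ, 0 ≤ t →
    (windowGraph a T μ t).Adj j k

/-! Coordinates decouple, so scalar trajectories suffice. If all values are nonnegative at time `t`,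
they remain so (`nonneg`), and after multiplication by `exp (N M t)` they are nondecreasing. An
arrow `i → k` over a window then forces the weighted value of `i` at the end to be at least `μ`
times that of `k` at the start (`mul_weighted_le`). Over `n` windows, `y k t ≤ C * y i (t + n T)`
whenever `i` reaches `k`.

Each of the three conditions makes any two agents reach a common `k` in a number of windows
independent of `t`. Applying the estimate to `max - y` from `i` and to `y - min` from `j` eliminates
`y k t` and contracts the diameter by `1 - C⁻¹` (`exists_contraction`). Geometric decay and
invariance of the convex hull give a common limit. -/

/-- Scalar Carathéodory solutions of the consensus dynamics. -/
structure IsScalarTrajectory {N : ℕ} (a : Fin N → Fin N → ℝ → ℝ) (y : Fin N → ℝ → ℝ) : Prop where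
  absolutelyContinuous : ∀ j, ∀ S : ℝ, 0 ≤ S → AbsolutelyContinuousOnInterval (y j) 0 S
  hasDerivAt : ∀ j, ∀ᵐ t ∂timeMeasure, HasDerivAt (y j) (∑ k, a j k t * (y k t - y j t)) t

/-- Nonnegative signals bounded by a constant `M`. -/
structure IsSignalBoundedBy {N : ℕ} (a : Fin N → Fin N → ℝ → ℝ) (M : ℝ) : Prop where
  const_nonneg : 0 ≤ M
  nonneg : ∀ j k, ∀ᵐ t ∂timeMeasure, 0 ≤ a j k t
  le : ∀ j k, ∀ᵐ t ∂timeMeasure, a j k t ≤ M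

lemma IsBoundedSignal.exists_isSignalBoundedBy {N : ℕ} {a : Fin N → Fin N → ℝ → ℝ}
    (ha : IsBoundedSignal a) : ∃ M, IsSignalBoundedBy a M := by
  obtain ⟨M, hM⟩ := ha.bounded
  exact ⟨|M|, abs_nonneg M, ha.nonneg,
    fun j k => (hM j k).mono fun t ht => ht.trans (le_abs_self M)⟩

/-- An almost everywhere lower bound on the derivative of an absolutely continuous function
bounds its increments from below. -/
lemma AbsolutelyContinuousOnInterval.integral_le_sub {f g : ℝ → ℝ} {t s : ℝ} (ht : 0 ≤ t)
    (hts : t ≤ s) (hf : AbsolutelyContinuousOnInterval f 0 s)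
    (hg : IntervalIntegrable g volume t s)
    (h : ∀ᵐ r ∂timeMeasure, ∃ v, HasDerivAt f v r ∧ (t ≤ r → r ≤ s → g r ≤ v)) :
    ∫ r in t..s, g r ≤ f s - f t := by
  have hf' : AbsolutelyContinuousOnInterval f t s := hf.mono (by
    rw [Set.uIcc_of_le hts, Set.uIcc_of_le (ht.trans hts)]
    exact Set.Icc_subset_Icc_left ht)
  rw [← hf'.integral_deriv_eq_sub]
  refine intervalIntegral.integral_mono_ae_restrict hts hg hf'.intervalIntegrable_deriv ?_
  have h' : ∀ᵐ r ∂volume.restrict (Set.Icc t s),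
      ∃ v, HasDerivAt f v r ∧ (t ≤ r → r ≤ s → g r ≤ v) :=
    ae_mono (Measure.restrict_mono (fun r hr => ht.trans hr.1) le_rfl) h
  filter_upwards [h', ae_restrict_mem measurableSet_Icc] with r ⟨v, hv, hle⟩ hr
  rw [hv.deriv]
  exact hle hr.1 hr.2

/-! ### Positivity and transfer of mass along arrows -/

namespace IsScalarTrajectory

variable {N : ℕ} {a : Fin N → Fin N → ℝ → ℝ} {y : Fin N → ℝ → ℝ}

/-- The dynamics involve only differences, so the origin may be moved to the current minimum. -/
lemma sub_const (hy : IsScalarTrajectory a y) (c : ℝ) :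
    IsScalarTrajectory a fun j t => y j t - c where
  absolutelyContinuous j S hS := (hy.absolutelyContinuous j S hS).fun_sub
    contDiffOn_const.absolutelyContinuousOnInterval
  hasDerivAt j := (hy.hasDerivAt j).mono fun t ht => by
    simpa using ht.sub_const c

lemma const_sub (hy : IsScalarTrajectory a y) (c : ℝ) :
    IsScalarTrajectory a fun j t => c - y j t where
  absolutelyContinuous j S hS := (contDiffOn_const.absolutelyContinuousOnInterval).fun_sub
    (hy.absolutelyContinuous j S hS)
  hasDerivAt j := (hy.hasDerivAt j).mono fun t ht => by
    convert! ht.const_sub c using 1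
    rw [← Finset.sum_neg_distrib]
    exact Finset.sum_congr rfl fun k _ => by ring

lemma continuousOn (hy : IsScalarTrajectory a y) (j : Fin N) :
    ContinuousOn (y j) (Set.Ici 0) := by
  intro t ht
  have h0 : (0 : ℝ) ≤ t + 1 := add_nonneg ht zero_le_one
  have h := (hy.absolutelyContinuous j (t + 1) h0).continuousOn
  rw [Set.uIcc_of_le h0] at h
  refine (h t ⟨ht, by linarith⟩).mono_of_mem_nhdsWithin ?_
  filter_upwards [self_mem_nhdsWithin, mem_nhdsWithin_of_mem_nhds (Iio_mem_nhds (lt_add_one t))]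
    with r hr hr'
  exact ⟨hr, hr'.le⟩

/-- A scalar trajectory multiplied by the integrating factor `exp (N M t)`. -/
noncomputable def weighted (M : ℝ) (y : Fin N → ℝ → ℝ) (j : Fin N) (t : ℝ) : ℝ :=
  Real.exp (N * M * t) * y j t

lemma weighted_absolutelyContinuous (hy : IsScalarTrajectory a y) (M : ℝ) (j : Fin N) {S : ℝ}
    (hS : 0 ≤ S) : AbsolutelyContinuousOnInterval (weighted M y j) 0 S := by
  have h : ContDiffOn ℝ 1 (fun t : ℝ => Real.exp (N * M * t)) (Set.uIcc 0 S) := by fun_prop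
  exact h.absolutelyContinuousOnInterval.mul (hy.absolutelyContinuous j S hS)

/-- The weighted trajectory solves a linear system with nonnegative coefficients. -/
lemma weighted_hasDerivAt (hy : IsScalarTrajectory a y) {M : ℝ} (ha : IsSignalBoundedBy a M)
    (j : Fin N) : ∀ᵐ t ∂timeMeasure, ∃ c, 0 ≤ c ∧ c ≤ N * M ∧ (∀ k, 0 ≤ a j k t ∧ a j k t ≤ M) ∧
      HasDerivAt (weighted M y j) (∑ k, a j k t * weighted M y k t + c * weighted M y j t) t := by
  filter_upwards [hy.hasDerivAt j, ae_all_iff.2 (ha.nonneg j), ae_all_iff.2 (ha.le j)]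
    with t ht h0 hM
  -- The integrating factor contributes `N M`, which absorbs the damping `∑ k, a j k t`.
  refine ⟨N * M - ∑ k, a j k t, ?_, ?_, fun k => ⟨h0 k, hM k⟩, ?_⟩
  · have := Finset.sum_le_card_nsmul Finset.univ (fun k => a j k t) M fun k _ => hM k
    simpa using this
  · have := Finset.sum_nonneg fun k (_ : k ∈ Finset.univ) => h0 k
    linarith
  · have he : HasDerivAt (fun t : ℝ => Real.exp (N * M * t))
        (Real.exp (N * M * t) * (N * M)) t := by
      simpa using ((hasDerivAt_id t).const_mul (N * M : ℝ)).exp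
    convert! he.mul ht using 1
    simp only [weighted, mul_sub, Finset.sum_sub_distrib, ← Finset.sum_mul, sub_mul]
    have : ∑ k, a j k t * (Real.exp (N * M * t) * y k t)
        = Real.exp (N * M * t) * ∑ k, a j k t * y k t := by
      rw [Finset.mul_sum]
      exact Finset.sum_congr rfl fun k _ => by ring
    rw [this]
    ring

/-- Nonnegativity is preserved by the dynamics. -/
lemma nonneg (hy : IsScalarTrajectory a y) {M : ℝ} (ha : IsSignalBoundedBy a M) {t s : ℝ}
    (ht : 0 ≤ t) (h0 : ∀ j, 0 ≤ y j t) (hts : t ≤ s) (j : Fin N) : 0 ≤ y j s := by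
  have hM := ha.const_nonneg
  -- Grönwall on the total negative part `u`. Clamping time at `t` makes it continuous on all of
  -- `ℝ`.
  let w : Fin N → ℝ → ℝ := fun k r => max 0 (-weighted M y k (max t r))
  let u : ℝ → ℝ := fun r => ∑ k, w k r
  have hw0 : ∀ k r, 0 ≤ w k r := fun k r => le_max_left _ _
  have hwu : ∀ k r, w k r ≤ u r := fun k r =>
    Finset.single_le_sum (fun k _ => hw0 k r) (Finset.mem_univ k)
  have hu0 : ∀ r, 0 ≤ u r := fun r => Finset.sum_nonneg fun k _ => hw0 k r
  have hwz : ∀ k r, t ≤ r → -w k r ≤ weighted M y k r := fun k r hr => by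
    have := le_max_right 0 (-weighted M y k (max t r))
    simp only [w, max_eq_right hr] at this ⊢
    linarith
  have hyc : ∀ k, Continuous fun r => y k (max t r) := fun k =>
    (hy.continuousOn k).comp_continuous (by fun_prop) fun r => ht.trans (le_max_left _ _)
  have huc : Continuous u := by
    refine continuous_finsetSum _ fun k _ => continuous_const.max (Continuous.neg ?_)
    exact (by fun_prop : Continuous fun r => Real.exp (N * M * max t r)).mul (hyc k)
  have hU : ∀ r, HasDerivAt (fun s => ∫ r in t..s, u r) (u r) r := fun r =>
    intervalIntegral.integral_hasDerivAt_right (huc.intervalIntegrable _ _)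
      huc.stronglyMeasurable.stronglyMeasurableAtFilter huc.continuousAt
  have hU0 : ∀ r, t ≤ r → 0 ≤ ∫ q in t..r, u q := fun r hr =>
    intervalIntegral.integral_nonneg hr fun q _ => hu0 q
  -- One `N * M` bounds the coupling sum, the other the diagonal coefficient `c`.
  set K : ℝ := N * M + N * M with hK
  have hlow : ∀ k r, t ≤ r → -(K * ∫ q in t..r, u q) ≤ weighted M y k r := by
    intro k r hr
    have h1 : ∫ q in t..r, -(K * u q) ≤ weighted M y k r - weighted M y k t := by
      refine (hy.weighted_absolutelyContinuous M k (ht.trans hr)).integral_le_sub ht hr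
        (Continuous.intervalIntegrable (by fun_prop) _ _) ?_
      filter_upwards [hy.weighted_hasDerivAt ha k] with q ⟨c, hc0, hcM, hak, hd⟩
      refine ⟨_, hd, fun hq _ => ?_⟩
      have h2 : ∀ l, -(M * u q) ≤ a k l q * weighted M y l q := fun l => by
        have h3 := hwz l q hq
        have h4 := mul_le_mul (hak l).2 (hwu l q) (hw0 l q) hM
        have h5 := mul_le_mul_of_nonneg_left h3 (hak l).1
        linarith
      have h6 : -(N * M * u q) ≤ ∑ l, a k l q * weighted M y l q := by
        have := Finset.card_nsmul_le_sum Finset.univ _ _ fun l _ => h2 l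
        simp only [Finset.card_univ, Fintype.card_fin, nsmul_eq_mul] at this
        linarith
      have h7 := mul_le_mul hcM (hwu k q) (hw0 k q) (by positivity)
      have h8 := mul_le_mul_of_nonneg_left (hwz k q hq) hc0
      rw [hK]
      linarith
    rw [intervalIntegral.integral_neg, intervalIntegral.integral_const_mul] at h1
    have : 0 ≤ weighted M y k t := mul_nonneg (Real.exp_pos _).le (h0 k)
    linarith
  have hub : ∀ r, t ≤ r → u r ≤ N * K * ∫ q in t..r, u q := fun r hr => by
    have hK0 : 0 ≤ K := by positivity
    have h1 : ∀ k, w k r ≤ K * ∫ q in t..r, u q := fun k => by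
      refine max_le (mul_nonneg hK0 (hU0 r hr)) ?_
      rw [max_eq_right hr]
      linarith [hlow k r hr]
    have := Finset.sum_le_card_nsmul Finset.univ _ _ fun k _ => h1 k
    simp only [Finset.card_univ, Fintype.card_fin, nsmul_eq_mul] at this
    linarith
  -- The primitive of `u` starts at zero and has derivative at most `N * K` times itself, so it
  -- vanishes.
  have hgr := norm_le_gronwallBound_of_norm_deriv_right_le (f := fun s => ∫ r in t..s, u r)
    (f' := u) (δ := 0) (K := N * K) (ε := 0) (a := t) (b := s)
    (fun r _ => (hU r).continuousAt.continuousWithinAt) (fun r _ => (hU r).hasDerivWithinAt)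
    (by simp) (fun r hr => by
      rw [Real.norm_of_nonneg (hu0 r), Real.norm_of_nonneg (hU0 r hr.1), add_zero]
      exact hub r hr.1) s ⟨hts, le_rfl⟩
  rw [gronwallBound_ε0_δ0, norm_le_zero_iff] at hgr
  have hz := hlow j s hts
  rw [hgr, mul_zero, neg_zero] at hz
  exact nonneg_of_mul_nonneg_right hz (Real.exp_pos _)

/-- Nonnegative weighted trajectories are nondecreasing. -/
lemma weighted_mono (hy : IsScalarTrajectory a y) {M : ℝ} (ha : IsSignalBoundedBy a M) {t s : ℝ}
    (ht : 0 ≤ t) (h0 : ∀ j, 0 ≤ y j t) (hts : t ≤ s) (j : Fin N) :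
    weighted M y j t ≤ weighted M y j s := by
  have h : ∫ r in t..s, (0 : ℝ) ≤ weighted M y j s - weighted M y j t := by
    refine (hy.weighted_absolutelyContinuous M j (ht.trans hts)).integral_le_sub ht hts
      (by simp) ?_
    filter_upwards [hy.weighted_hasDerivAt ha j] with r ⟨c, hc0, _, hak, hd⟩
    refine ⟨_, hd, fun hr _ => ?_⟩
    have hz : ∀ k, 0 ≤ weighted M y k r := fun k =>
      mul_nonneg (Real.exp_pos _).le (hy.nonneg ha ht h0 hr k)
    exact add_nonneg (Finset.sum_nonneg fun k _ => mul_nonneg (hak k).1 (hz k))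
      (mul_nonneg hc0 (hz j))
  simpa using h

/-- An arrow `i → k` transfers a fixed proportion of the value of `k` to `i`. -/
lemma mul_weighted_le (hy : IsScalarTrajectory a y) {M : ℝ} (ha : IsSignalBoundedBy a M)
    {t T μ : ℝ} (ht : 0 ≤ t) (hT : 0 ≤ T) (hμ : 0 < μ) (h0 : ∀ j, 0 ≤ y j t) {i k : Fin N}
    (hik : (windowGraph a T μ t).Adj i k) :
    μ * weighted M y k t ≤ weighted M y i (t + T) := by
  have hts : t ≤ t + T := by linarith
  have hμ' : μ ≤ ∫ s in t..(t + T), a i k s := hik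
  -- A non-integrable function has integral `0` by convention, which `0 < μ` excludes.
  have hint : IntervalIntegrable (a i k) volume t (t + T) := by
    by_contra h
    rw [intervalIntegral.integral_undef h] at hμ'
    linarith
  have hz : ∀ r, t ≤ r → ∀ l, 0 ≤ weighted M y l r := fun r hr l =>
    mul_nonneg (Real.exp_pos _).le (hy.nonneg ha ht h0 hr l)
  have h : ∫ r in t..(t + T), a i k r * weighted M y k t
      ≤ weighted M y i (t + T) - weighted M y i t := by
    refine (hy.weighted_absolutelyContinuous M i (ht.trans hts)).integral_le_sub ht hts
      (hint.mul_const _) ?_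
    filter_upwards [hy.weighted_hasDerivAt ha i] with r ⟨c, hc0, _, hak, hd⟩
    refine ⟨_, hd, fun hr _ => ?_⟩
    have h1 := Finset.single_le_sum (f := fun l => a i l r * weighted M y l r)
      (fun l _ => mul_nonneg (hak l).1 (hz r hr l)) (Finset.mem_univ k)
    have h2 := mul_le_mul_of_nonneg_left (hy.weighted_mono ha ht h0 hr k) (hak k).1
    have h3 := mul_nonneg hc0 (hz r hr i)
    linarith
  rw [intervalIntegral.integral_mul_const] at h
  have h1 := mul_le_mul_of_nonneg_right hμ' (hz t le_rfl k)
  linarith [hz t le_rfl i]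

/-- One window of backward propagation of smallness. -/
lemma le_of_step (hy : IsScalarTrajectory a y) {M : ℝ} (ha : IsSignalBoundedBy a M)
    {t T μ : ℝ} (ht : 0 ≤ t) (hT : 0 ≤ T) (hμ : 0 < μ) (h0 : ∀ j, 0 ≤ y j t) {i k : Fin N}
    (hik : i = k ∨ (windowGraph a T μ t).Adj i k) :
    y k t ≤ Real.exp (N * M * T) * (1 + μ⁻¹) * y i (t + T) := by
  have hts : t ≤ t + T := by linarith
  have hi := hy.nonneg ha ht h0 hts i
  -- The `1` serves the case of staying put, `μ⁻¹` that of following an arrow.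
  have key : weighted M y k t ≤ (1 + μ⁻¹) * weighted M y i (t + T) := by
    have hw : 0 ≤ weighted M y i (t + T) := mul_nonneg (Real.exp_pos _).le hi
    have hμw : 0 ≤ μ⁻¹ * weighted M y i (t + T) := by positivity
    rcases hik with rfl | hik
    · linarith [hy.weighted_mono ha ht h0 hts i]
    · have h1 := (le_inv_mul_iff₀ hμ).2 (hy.mul_weighted_le ha ht hT hμ h0 hik)
      linarith
  simp only [weighted, mul_add, Real.exp_add] at key
  refine le_of_mul_le_mul_left ?_ (Real.exp_pos (N * M * t))
  linarith

end IsScalarTrajectory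

/-! ### Common targets from each of the three conditions -/

/-- `i` reaches `k` by traversing `n` consecutive windows backward in time, from `t + n T` to `t`,
each time staying put or following an arrow of the window graph. -/
def windowReach {N : ℕ} (a : Fin N → Fin N → ℝ → ℝ) (T μ t : ℝ) : ℕ → Fin N → Fin N → Prop
  | 0, i, k => i = k
  | n + 1, i, k => ∃ m, (i = m ∨ (windowGraph a T μ (t + n * T)).Adj i m) ∧
      windowReach a T μ t n m k

/-- Any two agents reach a common agent within a fixed number of windows. -/
def HasCommonWindowTarget {N : ℕ} (a : Fin N → Fin N → ℝ → ℝ) : Prop :=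
  ∃ T μ : ℝ, 0 < T ∧ 0 < μ ∧ ∃ n : ℕ, ∀ t : ℝ, 0 ≤ t → ∀ i j, ∃ k,
    windowReach a T μ t n i k ∧ windowReach a T μ t n j k

section WindowReach

variable {N : ℕ} {a : Fin N → Fin N → ℝ → ℝ}

lemma windowReach.mono {T μ t : ℝ} {i k : Fin N} {n m : ℕ} (hnm : n ≤ m)
    (h : windowReach a T μ t n i k) : windowReach a T μ t m i k := by
  induction m, hnm using Nat.le_induction with
  | base => exact h
  | succ m _ ih => exact ⟨i, Or.inl rfl, ih⟩

/-- Persistent arrows are present in every window, so the path length serves for all `t`. -/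
lemma exists_windowReach_of_reflTransGen {T μ : ℝ} (hT : 0 ≤ T) {i l : Fin N}
    (h : Relation.ReflTransGen (persistentGraph a T μ).Adj i l) :
    ∃ n : ℕ, ∀ t : ℝ, 0 ≤ t → windowReach a T μ t n i l := by
  induction h using Relation.ReflTransGen.head_induction_on with
  | refl => exact ⟨0, fun _ _ => rfl⟩
  | head hik _ ih =>
    obtain ⟨n, hn⟩ := ih
    exact ⟨n + 1, fun t ht => ⟨_, Or.inr (hik _ (by positivity)), hn t ht⟩⟩

lemma MoreauCondition.hasCommonWindowTarget (h : MoreauCondition a) :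
    HasCommonWindowTarget a := by
  obtain ⟨T, μ, hT, hμ, l, hl⟩ := h
  choose n hn using fun i => exists_windowReach_of_reflTransGen hT.le (hl i)
  -- Shorter paths are padded with idle windows.
  have hle : ∀ i, n i ≤ Finset.univ.sup n := fun i => Finset.le_sup (Finset.mem_univ i)
  exact ⟨T, μ, hT, hμ, Finset.univ.sup n, fun t ht i j =>
    ⟨l, (hn i t ht).mono (hle i), (hn j t ht).mono (hle j)⟩⟩

lemma IntegralScramblingCondition.hasCommonWindowTarget (h : IntegralScramblingCondition a) :
    HasCommonWindowTarget a := by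
  obtain ⟨T, μ, hT, hμ, h⟩ := h
  refine ⟨T, μ, hT, hμ, 1, fun t ht i j => ?_⟩
  by_cases hij : i = j
  · exact ⟨i, ⟨i, Or.inl rfl, rfl⟩, ⟨i, Or.inl hij.symm, rfl⟩⟩
  · obtain ⟨k, hi, hj⟩ := h i j hij t ht
    exact ⟨k, ⟨k, Or.inr (by simpa using hi), rfl⟩, ⟨k, Or.inr (by simpa using hj), rfl⟩⟩

lemma PersistentExcitation.hasCommonWindowTarget (h : PersistentExcitation a) :
    HasCommonWindowTarget a := by
  obtain ⟨T, μ, hT, hμ, h⟩ := h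
  refine ⟨T, μ, hT, hμ, 1, fun t ht i j => ⟨j, ⟨j, ?_, rfl⟩, ⟨j, Or.inl rfl, rfl⟩⟩⟩
  by_cases hij : i = j
  · exact Or.inl hij
  · exact Or.inr (by simpa using h i j hij t ht)

end WindowReach

/-! ### Contraction of the diameter and scalar consensus -/

namespace IsScalarTrajectory

variable {N : ℕ} {a : Fin N → Fin N → ℝ → ℝ} {y : Fin N → ℝ → ℝ}

lemma le_of_windowReach (hy : IsScalarTrajectory a y) {M : ℝ} (ha : IsSignalBoundedBy a M)
    {t T μ : ℝ} (ht : 0 ≤ t) (hT : 0 ≤ T) (hμ : 0 < μ) (h0 : ∀ j, 0 ≤ y j t) {n : ℕ}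
    {i k : Fin N} (hik : windowReach a T μ t n i k) :
    y k t ≤ (Real.exp (N * M * T) * (1 + μ⁻¹)) ^ n * y i (t + n * T) := by
  induction n generalizing i with
  | zero =>
    obtain rfl : i = k := hik
    simp
  | succ n ih =>
    obtain ⟨m, him, hmk⟩ := hik
    have htn : 0 ≤ (n : ℝ) * T := by positivity
    have h1 := hy.le_of_step ha (by positivity) hT hμ
      (fun j => hy.nonneg ha ht h0 (by linarith : t ≤ t + n * T) j) him
    have h2 := (ih hmk).trans (mul_le_mul_of_nonneg_left h1 (by positivity))
    convert! h2 using 1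
    push_cast
    rw [pow_succ, mul_assoc]
    congr 3
    ring

lemma bounds (hy : IsScalarTrajectory a y) {M : ℝ} (ha : IsSignalBoundedBy a M) {t s p q : ℝ}
    (ht : 0 ≤ t) (h : ∀ j, p ≤ y j t ∧ y j t ≤ q) (hts : t ≤ s) (j : Fin N) :
    p ≤ y j s ∧ y j s ≤ q := by
  have h1 := (hy.sub_const p).nonneg ha ht (fun j => sub_nonneg.2 (h j).1) hts j
  have h2 := (hy.const_sub q).nonneg ha ht (fun j => sub_nonneg.2 (h j).2) hts j
  exact ⟨sub_nonneg.1 h1, sub_nonneg.1 h2⟩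

/-- The diameter contracts by a fixed factor over a fixed number of windows. -/
lemma exists_contraction (hN : 0 < N) (hy : IsScalarTrajectory a y) {M : ℝ}
    (ha : IsSignalBoundedBy a M) (hG : HasCommonWindowTarget a) :
    ∃ L : ℝ, 0 ≤ L ∧ ∃ c : ℝ, 0 ≤ c ∧ c < 1 ∧ ∀ t D : ℝ, 0 ≤ t → (∀ i j, y i t - y j t ≤ D) →
      ∀ i j, y i (t + L) - y j (t + L) ≤ c * D := by
  obtain ⟨T, μ, hT, hμ, n, hG⟩ := hG
  have : Nonempty (Fin N) := ⟨⟨0, hN⟩⟩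
  have hM := ha.const_nonneg
  set C : ℝ := (Real.exp (N * M * T) * (1 + μ⁻¹)) ^ n with hCdef
  have hC : 1 ≤ C := by
    refine one_le_pow₀ (one_le_mul_of_one_le_of_one_le (Real.one_le_exp (by positivity)) ?_)
    have := inv_pos.2 hμ
    linarith
  have hC0 : 0 < C := by linarith
  refine ⟨n * T, by positivity, 1 - C⁻¹, sub_nonneg.2 (inv_le_one_of_one_le₀ hC),
    sub_lt_self _ (inv_pos.2 hC0), fun t D ht hD i j => ?_⟩
  obtain ⟨p, hp⟩ := Finite.exists_min fun l => y l t
  obtain ⟨q, hq⟩ := Finite.exists_max fun l => y l t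
  obtain ⟨k, hik, hjk⟩ := hG t ht i j
  -- The distance of `k` below the maximum is controlled through `i`, its distance above the minimum
  -- through `j`; adding the two cancels `y k t`.
  have h1 := (hy.const_sub (y q t)).le_of_windowReach ha ht hT.le hμ
    (fun l => sub_nonneg.2 (hq l)) hik
  have h2 := (hy.sub_const (y p t)).le_of_windowReach ha ht hT.le hμ
    (fun l => sub_nonneg.2 (hp l)) hjk
  rw [← hCdef] at h1 h2
  have h3 : y q t - y p t
      ≤ C * (y q t - y p t - (y i (t + n * T) - y j (t + n * T))) := by linarith
  have h4 := (inv_mul_le_iff₀ hC0).2 h3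
  have h5 := mul_le_mul_of_nonneg_left (hD q p) (sub_nonneg.2 (inv_le_one_of_one_le₀ hC))
  linarith

/-- Scalar trajectories converge to consensus. -/
lemma exists_tendsto (hN : 0 < N) (hy : IsScalarTrajectory a y) {M : ℝ}
    (ha : IsSignalBoundedBy a M) (hG : HasCommonWindowTarget a) :
    ∃ p : ℝ, ∀ j, Tendsto (y j) atTop (𝓝 p) := by
  have : Nonempty (Fin N) := ⟨⟨0, hN⟩⟩
  obtain ⟨L, hL, c, hc0, hc1, hcontr⟩ := hy.exists_contraction hN ha hG
  obtain ⟨p₀, hp₀⟩ := Finite.exists_min fun l => y l 0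
  obtain ⟨q₀, hq₀⟩ := Finite.exists_max fun l => y l 0
  have hdiam : ∀ n : ℕ, ∀ i j, y i (n * L) - y j (n * L) ≤ c ^ n * (y q₀ 0 - y p₀ 0) := by
    intro n
    induction n with
    | zero =>
      intro i j
      simpa using sub_le_sub (hq₀ i) (hp₀ j)
    | succ n ih =>
      intro i j
      have := hcontr (n * L) _ (by positivity) ih i j
      rw [pow_succ', mul_assoc]
      convert! this using 3 <;> (push_cast; ring)
  -- Decay is known only at multiples of `L`; `bounds` extends it to all later times. Two different
  -- times give the Cauchy property, two different agents the common limit.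
  have hclose : ∀ ε > 0, ∃ τ : ℝ, ∀ s ≥ τ, ∀ r ≥ τ, ∀ i j, dist (y i s) (y j r) < ε := by
    intro ε hε
    have hlim : Tendsto (fun n : ℕ => c ^ n * (y q₀ 0 - y p₀ 0)) atTop (𝓝 0) := by
      simpa using (tendsto_pow_atTop_nhds_zero_of_lt_one hc0 hc1).mul_const (y q₀ 0 - y p₀ 0)
    obtain ⟨n, hn⟩ := (hlim.eventually (gt_mem_nhds hε)).exists
    obtain ⟨p, hp⟩ := Finite.exists_min fun l => y l (n * L)
    obtain ⟨q, hq⟩ := Finite.exists_max fun l => y l (n * L)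
    refine ⟨n * L, fun s hs r hr i j => ?_⟩
    have h1 := hy.bounds ha (by positivity) (fun l => ⟨hp l, hq l⟩) hs i
    have h2 := hy.bounds ha (by positivity) (fun l => ⟨hp l, hq l⟩) hr j
    refine (Real.dist_le_of_mem_Icc h1 h2).trans_lt ((hdiam n q p).trans_lt hn)
  have hcauchy : Cauchy (map (y p₀) atTop) := by
    refine Metric.cauchy_iff.2 ⟨inferInstance, fun ε hε => ?_⟩
    obtain ⟨τ, hτ⟩ := hclose ε hε
    refine ⟨y p₀ '' Set.Ici τ, image_mem_map (Ici_mem_atTop τ), ?_⟩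
    rintro _ ⟨s, hs, rfl⟩ _ ⟨r, hr, rfl⟩
    exact hτ s hs r hr p₀ p₀
  obtain ⟨p, hp⟩ := CompleteSpace.complete hcauchy
  refine ⟨p, fun j => ?_⟩
  refine tendsto_iff_of_dist ?_ |>.1 (show Tendsto (y p₀) atTop (𝓝 p) from hp)
  refine Metric.tendsto_atTop.2 fun ε hε => ?_
  obtain ⟨τ, hτ⟩ := hclose ε hε
  refine ⟨τ, fun s hs => ?_⟩
  rw [Real.dist_0_eq_abs, abs_of_nonneg dist_nonneg]
  exact hτ s hs s hs p₀ j

end IsScalarTrajectory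

/-! ### Reduction to coordinates -/

lemma IsTrajectory.coord {N d : ℕ} {a : Fin N → Fin N → ℝ → ℝ}
    {x : Fin N → ℝ → EuclideanSpace ℝ (Fin d)} (hx : IsTrajectory a x) (m : Fin d) :
    IsScalarTrajectory a fun j t => x j t m where
  absolutelyContinuous j S hS := by
    have h := hx.absolutelyContinuous j S hS
    rw [absolutelyContinuousOnInterval_iff] at h ⊢
    intro ε hε
    obtain ⟨δ, hδ, h⟩ := h ε hε
    refine ⟨δ, hδ, fun E hE hlen => (Finset.sum_le_sum fun i _ => ?_).trans_lt (h E hE hlen)⟩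
    rw [dist_eq_norm, dist_eq_norm]
    exact PiLp.norm_apply_le (x j (E.2 i).1 - x j (E.2 i).2) m
  hasDerivAt j := (hx.hasDerivAt j).mono fun t ht => by
    convert! (EuclideanSpace.proj (𝕜 := ℝ) m).hasFDerivAt.comp_hasDerivAt t ht using 1
    simp

theorem mainTheorem5 {N d : ℕ} (a : Fin N → Fin N → ℝ → ℝ) (ha : IsBoundedSignal a)
    (hcond : MoreauCondition a ∨ IntegralScramblingCondition a ∨ PersistentExcitation a)
    (x : Fin N → ℝ → EuclideanSpace ℝ (Fin d)) (hx : IsTrajectory a x) :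
    ConvergesToConsensus x := by
  rcases Nat.eq_zero_or_pos N with rfl | hN
  · exact ⟨0, fun j => j.elim0⟩
  obtain ⟨M, hM⟩ := ha.exists_isSignalBoundedBy
  have hG : HasCommonWindowTarget a := by
    rcases hcond with h | h | h
    exacts [h.hasCommonWindowTarget, h.hasCommonWindowTarget, h.hasCommonWindowTarget]
  choose p hp using fun m => (hx.coord m).exists_tendsto hN hM hG
  refine ⟨WithLp.toLp 2 p, fun j => ?_⟩
  have h : Tendsto (fun t => (x j t).ofLp) atTop (𝓝 p) := tendsto_pi_nhds.2 fun m => hp m j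
  exact ((PiLp.continuous_toLp 2 fun _ : Fin d => ℝ).tendsto p).comp h
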